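/- **Setting.** Let $\mathcal H$ be a separable complex Hilbert space and $B,C\in\mathcal B(\mathcal H)$ with $B^*B+C^*C=I$. Let $\mathcal K=\ell^2(\mathbb Z)$ with its standard orthonormal basis $(|i\rangle)_{i\in\mathbb Z}$. *Walk.* A state is a density operator $\rho=\sum_{i\in\mathbb Z}\rho_i\otimes|i\rangle\langle i|$ on $\mathcal H\otimes\mathcal K$, with $\rho_i\ge 0$ trace class and $\sum_i\mathrm{Tr}(\rho_i)=1$. The nearest-neighbour open quantum random walk (OQRW) on $\mathbb Z$, with $B^{i-1}_i=B$, $B^{i+1}_i=C$ and $B^i_j=0$ otherwise, is $$\mathcal M(\rho)=\sum_j\bigl(B\rho_{j+1}B^*+C\rho_{j-1}C^*\bigr)\otimes|j\rangle\langle j| .$$ Let $\mathcal B$ be the von Neumann algebra of block-diagonal operators $x=\sum_i x(i)\otimes|i\rangle\langle i|$, $\sup_i\|x(i)\|<\infty$. A state $\rho$ is faithful if $x\in\mathcal B$, $x\ge0$ and $\mathrm{Tr}(\rho x)=0$ imply $x=0$. *Quantum Markov chain.* Given an initial state $\rho^{(0)}$, put $\rho^{(n)}=\mathcal M^n(\rho^{(0)})$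 and, for $x,y\in\mathcal B$, $$\mathcal E^{(n)}(x\otimes y)=\sum_{j:\rho^{(n)}_j\ne0}\frac{\mathrm{Tr}(\rho^{(n)}_jx(j))}{\mathrm{Tr}(\rho^{(n)}_j)}\sum_i (B^i_j)^*\,y(i)\,B^i_j\otimes|j\rangle\langle j| .$$ Let $\bar b(n)$ be the strong limit, as $k\to\infty$, of $\mathcal E^{(n)}(I\otimes\mathcal E^{(n+1)}(I\otimes\cdots\otimes\mathcal E^{(n+k)}(I\otimes I)))$. On observables of the first $n+1$ factors of $\bigotimes_{k\ge 0}\mathcal B$ let $E_{0]}$ be the linear map with $$E_{0]}(a_0\otimes\cdots\otimes a_n\otimes I\otimes\cdots)=\mathcal E^{(0)}\bigl(a_0\otimes\mathcal E^{(1)}(a_1\otimes\cdots\otimes\mathcal E^{(n)}(a_n\otimes\bar b(n+1)))\bigr),$$ extended to infinite products as the strong limit of its values on truncations. The pair $(\rho^{(0)},(\mathcal E^{(n)})_{n\ge0})$ is the quantum Markov chain (QMC) associated with the OQRW. It is *reducible* if there are a projection $p\in\mathcal B$, $p\ne0,I$, and $n_0\ge0$ such that, with $p_{[n_0}=I\otimes\cdots\otimes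 I\otimes p\otimes p\otimes\cdots$ ($p$ in all factors of index $\ge n_0$), $$E_{0]}(p_{[n_0}\,a\,p_{[n_0})=E_{0]}(a)$$ for all local observables $a$ (finite linear combinations of $a_0\otimes\cdots\otimes a_m\otimes I\otimes I\otimes\cdots$), where the left side means $\lim_{n\to\infty}E_{0]}(p_{[n_0,n]}\,a\,p_{[n_0,n]})$ in the strong operator topology, tested on vectors supported at a single site, and $p_{[n_0,n]}$ has $p$ in the factors $n_0\le k\le n$ and $I$ elsewhere. Otherwise it is *irreducible*. **Proposition.** Suppose that, for every $x\in\mathcal B(\mathcal H)$ with $x\ge0$, $B^*xB=0$ and $C^*xC=0$ together imply $x=0$. Then $\mathcal M(\rho)$ is faithful for every faithful state $\rho$. Moreover, for every faithful initial state $\rho^{(0)}$, the QMC associated with the OQRW is irreducible. -/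

import Mathlib

open scoped InnerProductSpace ENNReal TensorProduct BoundedContinuousFunction

noncomputable section

namespace OQRW

variable {H : Type*} [NormedAddCommGroup H] [InnerProductSpace ℂ H] [CompleteSpace H]

/-! ### Trace and trace class operators -/

section Trace

variable (H) in
/-- The index set of an orthonormal basis of `H`, chosen once and for all. -/
def basisSet : Set H := (exists_hilbertBasis ℂ H).choose

variable (H) in
/-- An orthonormal basis of `H`, chosen once and for all. -/
def basis : HilbertBasis (basisSet H) ℂ H := (exists_hilbertBasis ℂ H).choose_spec.choose

/-- `T` is trace class: `∑ₖ ⟨eₖ, |T| eₖ⟩ < ∞`. -/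
def IsTraceClass (T : H →L[ℂ] H) : Prop :=
  Summable fun k => ⟪basis H k, CFC.abs T (basis H k)⟫_ℂ

/-- The trace `∑ₖ ⟨eₖ, T eₖ⟩` (of a trace class operator). -/
def trace (T : H →L[ℂ] H) : ℂ := ∑' k, ⟪basis H k, T (basis H k)⟫_ℂ

/-- The square of the Hilbert-Schmidt norm, with values in `[0, ∞]`. -/
def hs (A : H →L[ℂ] H) : ℝ≥0∞ := ∑' k, ‖A (basis H k)‖ₑ ^ 2

theorem tsum_enorm_inner_sq (x : H) :
    ∑' k, ‖⟪basis H k, x⟫_ℂ‖ₑ ^ 2 = ‖x‖ₑ ^ 2 := by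
  have h := (basis H).hasSum_inner_mul_inner x x
  have h2 : HasSum (fun k => ‖⟪basis H k, x⟫_ℂ‖ ^ 2) (‖x‖ ^ 2) := by
    have := Complex.hasSum_re h
    convert this using 1
    · funext k
      rw [← inner_conj_symm x, Complex.conj_mul']
      norm_cast
    · exact (inner_self_eq_norm_sq (𝕜 := ℂ) x).symm
  have h3 := ENNReal.ofReal_tsum_of_nonneg (fun k => sq_nonneg ‖⟪basis H k, x⟫_ℂ‖) h2.summable
  rw [h2.tsum_eq] at h3
  rw [← ofReal_norm x, ← ENNReal.ofReal_pow (norm_nonneg _), h3]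
  congr 1
  funext k
  rw [ENNReal.ofReal_pow (norm_nonneg _), ofReal_norm]

theorem hs_star (A : H →L[ℂ] H) : hs (star A) = hs A := by
  have h : ∀ S : H →L[ℂ] H, hs S = ∑' k, ∑' l, ‖⟪basis H l, S (basis H k)⟫_ℂ‖ₑ ^ 2 := fun S => by
    unfold hs
    congr 1; funext k
    exact (tsum_enorm_inner_sq _).symm
  rw [h, h, ENNReal.tsum_comm]
  congr 1; funext k; congr 1; funext l
  rw [ContinuousLinearMap.star_eq_adjoint, ContinuousLinearMap.adjoint_inner_right,
    ← inner_conj_symm, RCLike.enorm_conj]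

theorem hs_mul_le (A S : H →L[ℂ] H) : hs (A * S) ≤ ‖A‖ₑ ^ 2 * hs S := by
  unfold hs
  rw [← ENNReal.tsum_mul_left]
  refine ENNReal.tsum_le_tsum fun k => ?_
  rw [← mul_pow]
  gcongr
  exact A.le_opENorm _

theorem hs_mul_le' (S A : H →L[ℂ] H) : hs (S * A) ≤ ‖A‖ₑ ^ 2 * hs S := by
  rw [← hs_star (S * A), star_mul, ← hs_star S]
  refine (hs_mul_le _ _).trans_eq ?_
  congr 2
  rw [← ofReal_norm, ← ofReal_norm, norm_star]

theorem hs_ne_top_mul {S : H →L[ℂ] H} (hS : hs S ≠ ⊤) (A : H →L[ℂ] H) : hs (S * A) ≠ ⊤ :=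
  ne_top_of_le_ne_top (ENNReal.mul_ne_top (by simp) hS) (hs_mul_le' S A)

theorem summable_of_hs_ne_top {S : H →L[ℂ] H} (hS : hs S ≠ ⊤) :
    Summable fun k => ‖S (basis H k)‖ ^ 2 := by
  have := ENNReal.summable_toReal hS
  simpa using this

theorem toReal_hs (S : H →L[ℂ] H) : (hs S).toReal = ∑' k, ‖S (basis H k)‖ ^ 2 := by
  unfold hs
  rw [ENNReal.tsum_toReal_eq (by simp)]
  simp

theorem inner_star_mul (S A : H →L[ℂ] H) (x : H) :
    ⟪x, (star S * A) x⟫_ℂ = ⟪S x, A x⟫_ℂ := by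
  rw [ContinuousLinearMap.star_eq_adjoint, mul_apply_eq_comp,
    ContinuousLinearMap.adjoint_inner_right]

theorem inner_star_mul_self (S : H →L[ℂ] H) (x : H) :
    ⟪x, (star S * S) x⟫_ℂ = ((‖S x‖ ^ 2 : ℝ) : ℂ) := by
  rw [inner_star_mul, inner_self_eq_norm_sq_to_K]
  norm_cast

theorem trace_star_mul_self (S : H →L[ℂ] H) : trace (star S * S) = ((hs S).toReal : ℂ) := by
  unfold trace
  simp_rw [inner_star_mul_self]
  rw [toReal_hs, Complex.ofReal_tsum]

theorem isTraceClass_star_mul_self (S : H →L[ℂ] H) :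
    IsTraceClass (star S * S) ↔ hs S ≠ ⊤ := by
  unfold IsTraceClass
  rw [CFC.abs_of_nonneg _ (star_mul_self_nonneg S)]
  simp_rw [inner_star_mul_self]
  rw [Complex.summable_ofReal]
  refine ⟨fun h => ?_, summable_of_hs_ne_top⟩
  have h3 := ENNReal.ofReal_tsum_of_nonneg (fun k => sq_nonneg ‖S (basis H k)‖) h
  have : hs S = ENNReal.ofReal (∑' k, ‖S (basis H k)‖ ^ 2) := by
    rw [h3]; unfold hs
    congr 1; funext k
    rw [ENNReal.ofReal_pow (norm_nonneg _), ofReal_norm]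
  rw [this]; exact ENNReal.ofReal_ne_top

theorem exists_sqrt {T : H →L[ℂ] H} (hT : 0 ≤ T) : ∃ S : H →L[ℂ] H, T = star S * S := by
  obtain ⟨S, hS⟩ := CStarAlgebra.nonneg_iff_eq_star_mul_self.mp hT
  exact ⟨S, hS⟩

theorem norm_inner_le_aux (S A : H →L[ℂ] H) (x : H) :
    ‖⟪x, (star S * A) x⟫_ℂ‖ ≤ (‖S x‖ ^ 2 + ‖A x‖ ^ 2) / 2 := by
  rw [inner_star_mul]
  refine (norm_inner_le_norm _ _).trans ?_
  nlinarith [sq_nonneg (‖S x‖ - ‖A x‖)]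

/-- For trace class `T ≥ 0` and bounded `x` the series defining `Tr (T x)` converges. -/
theorem summable_trace_mul {T : H →L[ℂ] H} (hT : 0 ≤ T) (hc : IsTraceClass T)
    (x : H →L[ℂ] H) : Summable fun k => ⟪basis H k, (T * x) (basis H k)⟫_ℂ := by
  obtain ⟨S, rfl⟩ := exists_sqrt hT
  rw [isTraceClass_star_mul_self] at hc
  rw [mul_assoc]
  exact Summable.of_norm_bounded
    (((summable_of_hs_ne_top hc).add (summable_of_hs_ne_top (hs_ne_top_mul hc x))).div_const 2)
    fun k => norm_inner_le_aux _ _ _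

theorem trace_mul_add {T : H →L[ℂ] H} (hT : 0 ≤ T) (hc : IsTraceClass T)
    (x y : H →L[ℂ] H) : trace (T * (x + y)) = trace (T * x) + trace (T * y) := by
  unfold trace
  rw [← (summable_trace_mul hT hc x).tsum_add (summable_trace_mul hT hc y)]
  congr 1; funext k
  rw [mul_add, add_apply, inner_add_right]

theorem trace_mul_smul (T : H →L[ℂ] H) (c : ℂ) (x : H →L[ℂ] H) :
    trace (T * (c • x)) = c * trace (T * x) := by
  unfold trace
  rw [← tsum_mul_left]
  congr 1; funext k
  rw [mul_smul_comm, smul_apply, inner_smul_right]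

theorem norm_trace_mul_le {T : H →L[ℂ] H} (hT : 0 ≤ T) (hc : IsTraceClass T)
    (x : H →L[ℂ] H) : ‖trace (T * x)‖ ≤ (1 + ‖x‖ ^ 2) / 2 * ‖trace T‖ := by
  obtain ⟨S, rfl⟩ := exists_sqrt hT
  rw [isTraceClass_star_mul_self] at hc
  have hx := hs_ne_top_mul hc x
  have h1 := summable_of_hs_ne_top hc
  have h2 := summable_of_hs_ne_top hx
  rw [trace_star_mul_self, mul_assoc, Complex.norm_real, Real.norm_of_nonneg ENNReal.toReal_nonneg]
  have h4 : (hs (S * x)).toReal ≤ ‖x‖ ^ 2 * (hs S).toReal := by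
    have := ENNReal.toReal_mono (ENNReal.mul_ne_top (by simp) hc) (hs_mul_le' S x)
    simpa using this
  have h5 : ‖trace (star S * (S * x))‖ ≤
      ∑' k, (‖S (basis H k)‖ ^ 2 + ‖(S * x) (basis H k)‖ ^ 2) / 2 :=
    tsum_of_norm_bounded ((h1.add h2).div_const 2).hasSum fun k => norm_inner_le_aux _ _ _
  rw [tsum_div_const, h1.tsum_add h2, ← toReal_hs, ← toReal_hs] at h5
  linarith

end Trace

/-! ### Block-diagonal observables and states -/

variable (H) in
/-- The von Neumann algebra of block-diagonal operators `∑ᵢ a(i) ⊗ |i⟩⟨i|` on `H ⊗ ℓ²(ℤ)`: such an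
operator is the bounded family `(a(i))` of its blocks, with the operations performed blockwise. -/
abbrev Obs : Type _ := ℤ →ᵇ (H →L[ℂ] H)

variable (H) in
/-- A density operator `∑ᵢ ρᵢ ⊗ |i⟩⟨i|` on `H ⊗ ℓ²(ℤ)`. -/
structure State where
  block : ℤ → (H →L[ℂ] H)
  nonneg : ∀ i, 0 ≤ block i
  traceClass : ∀ i, IsTraceClass (block i)
  hasSum_trace : HasSum (fun i => trace (block i)) 1

/-- The expectation `ρ(a) = Tr (ρ a) = ∑ᵢ Tr (ρᵢ a(i))`. -/
def State.expect (ρ : State H) (a : Obs H) : ℂ := ∑' i, trace (ρ.block i * a i)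

/-- `ρ` is faithful: `ρ(a) = 0` for an observable `a ≥ 0` only if `a = 0`. -/
def State.Faithful (ρ : State H) : Prop :=
  ∀ a : Obs H, (∀ i, 0 ≤ a i) → ρ.expect a = 0 → a = 0

/-! ### Nonhomogeneous quantum Markov chains -/

section QMC

/-- Strong operator convergence of observables. (It is tested on vectors supported at a single
site, which suffices for uniformly bounded sequences.) -/
def StrongTendsto (u : ℕ → Obs H) (b : Obs H) : Prop :=
  ∀ (i : ℤ) (ψ : H), Filter.Tendsto (fun n => u n i ψ) Filter.atTop (nhds (b i ψ))

variable (E : ℕ → (Obs H →ₗ[ℂ] Obs H →ₗ[ℂ] Obs H))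

/-- `E⁽ⁿ⁾(I ⊗ E⁽ⁿ⁺¹⁾(I ⊗ ⋯ ⊗ E⁽ⁿ⁺ᵏ⁾(I ⊗ I)))`. -/
def unitIter : ℕ → ℕ → Obs H
  | n, 0 => E n 1 1
  | n, k + 1 => E n 1 (unitIter (n + 1) k)

/-- The strong limit `b̄(n)` of `E⁽ⁿ⁾(I ⊗ E⁽ⁿ⁺¹⁾(I ⊗ ⋯ ⊗ E⁽ⁿ⁺ᵏ⁾(I ⊗ I)))` as `k → ∞`. -/
def bBar (n : ℕ) : Obs H :=
  Classical.epsilon fun b => StrongTendsto (unitIter E n) b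

/-- The multilinear map
`(a₀, …, aₗ₋₁) ↦ E⁽ᵐ⁾(a₀ ⊗ E⁽ᵐ⁺¹⁾(a₁ ⊗ ⋯ ⊗ E⁽ᵐ⁺ˡ⁻¹⁾(aₗ₋₁ ⊗ b̄(m + l))))`. -/
def nested : (l m : ℕ) → MultilinearMap ℂ (fun _ : Fin l => Obs H) (Obs H)
  | 0, m => MultilinearMap.constOfIsEmpty ℂ _ (bBar E m)
  | l + 1, m => LinearMap.uncurryLeft
      { toFun := fun a => (E m a).compMultilinearMap (nested l (m + 1))
        map_add' := fun a b => by ext v : 1; simp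
        map_smul' := fun c a => by ext v : 1; simp }

variable (H) in
/-- The observables `a₀ ⊗ ⋯ ⊗ aₙ₋₁ ⊗ I ⊗ I ⊗ ⋯` (and their linear combinations) that are localized
in the first `n` sites of the chain. -/
abbrev Local (n : ℕ) : Type _ := PiTensorProduct ℂ (fun _ : Fin n => Obs H)

/-- The inclusion `a ↦ a ⊗ I ⊗ ⋯ ⊗ I` of the observables of the first `n` sites
into those of the first `n + k` sites. -/
def Local.extend {n : ℕ} (k : ℕ) (a : Local H n) : Local H (n + k) :=
  PiTensorProduct.reindex ℂ (fun _ => Obs H) finSumFinEquiv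
    (PiTensorProduct.tmulEquiv ℂ (Obs H) (a ⊗ₜ[ℂ] (1 : Local H k)))

theorem Local.extend_tprod {n : ℕ} (k : ℕ) (a : Fin n → Obs H) :
    Local.extend k (PiTensorProduct.tprod ℂ a) =
      PiTensorProduct.tprod ℂ (Fin.append a fun _ : Fin k => 1) := by
  unfold Local.extend
  rw [PiTensorProduct.one_def]
  erw [PiTensorProduct.tmulEquiv_apply]
  rw [PiTensorProduct.reindex_tprod]
  congr 1
  funext i
  refine Fin.addCases (fun j => ?_) (fun j => ?_) i <;> simp

/-- The map `E_{0]}` on local observables. -/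
def expectZero (n : ℕ) : Local H n →ₗ[ℂ] Obs H := PiTensorProduct.lift (nested E n 0)

/-- The tensor product of `I` at the sites `k < n₀` and of `p` at the sites `n₀ ≤ k < n`. -/
def truncProj (p : Obs H) (n₀ n : ℕ) : Local H n :=
  PiTensorProduct.tprod ℂ fun k : Fin n => if (k : ℕ) < n₀ then 1 else p

/-- `p_{[n₀} = I ⊗ ⋯ ⊗ I ⊗ p ⊗ p ⊗ ⋯` is a reducing projection:
`E_{0]}(p_{[n₀} a p_{[n₀}) = E_{0]}(a)` for all local `a`. The value of `E_{0]}` on the left is, as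
for every infinite product, the limit of its values on the truncations to the first sites. -/
def IsReducing (p : Obs H) (n₀ : ℕ) : Prop :=
  ∀ (m : ℕ) (a : Local H m),
    StrongTendsto
      (fun k => expectZero E (m + k)
        (truncProj p n₀ (m + k) * a.extend k * truncProj p n₀ (m + k)))
      (expectZero E m a)

/-- There is a nontrivial reducing projection. -/
def IsReducible : Prop :=
  ∃ (p : Obs H) (n₀ : ℕ), IsStarProjection p ∧ p ≠ 0 ∧ p ≠ 1 ∧ IsReducing E p n₀

end QMC

/-! ### The nearest-neighbour open quantum random walk on `ℤ` -/

variable (H) in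
/-- The operators `B` (step `i → i - 1`) and `C` (step `i → i + 1`), with `B* B + C* C = I`. -/
structure NNWalk where
  B : H →L[ℂ] H
  C : H →L[ℂ] H
  isometry : star B * B + star C * C = 1

namespace NNWalk

variable (W : NNWalk H)

/-- The blocks of `M(ρ) = ∑ⱼ (B ρⱼ₊₁ B* + C ρⱼ₋₁ C*) ⊗ |j⟩⟨j|`. -/
def stepBlock (ρ : ℤ → (H →L[ℂ] H)) (j : ℤ) : H →L[ℂ] H :=
  W.B * ρ (j + 1) * star W.B + W.C * ρ (j - 1) * star W.C

theorem star_conj_eq (S A : H →L[ℂ] H) :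
    A * (star S * S) * star A = star (S * star A) * (S * star A) := by
  simp [mul_assoc]

theorem trace_conj_eq (S A : H →L[ℂ] H) :
    trace (A * (star S * S) * star A) = ((hs (A * star S)).toReal : ℂ) := by
  rw [star_conj_eq, trace_star_mul_self, ← hs_star]
  simp

theorem conj_nonneg' {T : H →L[ℂ] H} (hT : 0 ≤ T) (A : H →L[ℂ] H) : 0 ≤ A * T * star A := by
  obtain ⟨S, rfl⟩ := exists_sqrt hT
  rw [star_conj_eq]
  exact star_mul_self_nonneg _

theorem isTraceClass_conj {T : H →L[ℂ] H} (hT : 0 ≤ T) (hc : IsTraceClass T)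
    (A : H →L[ℂ] H) : IsTraceClass (A * T * star A) := by
  obtain ⟨S, rfl⟩ := exists_sqrt hT
  rw [star_conj_eq, isTraceClass_star_mul_self]
  exact hs_ne_top_mul ((isTraceClass_star_mul_self S).1 hc) _

theorem isTraceClass_add {T U : H →L[ℂ] H} (hT : 0 ≤ T) (hU : 0 ≤ U) (hc : IsTraceClass T)
    (hd : IsTraceClass U) : IsTraceClass (T + U) := by
  unfold IsTraceClass at *
  rw [CFC.abs_of_nonneg _ hT] at hc
  rw [CFC.abs_of_nonneg _ hU] at hd
  rw [CFC.abs_of_nonneg _ (add_nonneg hT hU)]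
  simpa [inner_add_right] using hc.add hd

theorem trace_add {T U : H →L[ℂ] H} (hT : 0 ≤ T) (hU : 0 ≤ U) (hc : IsTraceClass T)
    (hd : IsTraceClass U) : trace (T + U) = trace T + trace U := by
  have h1 := summable_trace_mul hT hc 1
  have h2 := summable_trace_mul hU hd 1
  rw [mul_one] at h1 h2
  unfold trace
  rw [← h1.tsum_add h2]
  congr 1; funext k
  rw [add_apply, inner_add_right]

theorem hs_add_eq (S : H →L[ℂ] H) : hs (W.B * S) + hs (W.C * S) = hs S := by
  unfold hs
  rw [← ENNReal.tsum_add]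
  congr 1; funext k
  have key : ∀ x : H, ‖W.B x‖ ^ 2 + ‖W.C x‖ ^ 2 = ‖x‖ ^ 2 := fun x => by
    have h := congrArg (fun T : H →L[ℂ] H => ⟪x, T x⟫_ℂ) W.isometry
    simp only [add_apply, inner_add_right, inner_star_mul_self,
      one_apply_eq_self, inner_self_eq_norm_sq_to_K] at h
    rw [← Complex.ofReal_add] at h
    exact Complex.ofReal_injective (h.trans (Complex.ofReal_pow _ _).symm)
  simp only [← ofReal_norm, mul_apply_eq_comp]
  rw [← ENNReal.ofReal_pow (norm_nonneg _), ← ENNReal.ofReal_pow (norm_nonneg _),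
    ← ENNReal.ofReal_pow (norm_nonneg _), ← ENNReal.ofReal_add (by positivity) (by positivity), key]

theorem trace_split {T : H →L[ℂ] H} (hT : 0 ≤ T) (hc : IsTraceClass T) :
    trace (W.B * T * star W.B) + trace (W.C * T * star W.C) = trace T := by
  obtain ⟨S, rfl⟩ := exists_sqrt hT
  have h := (isTraceClass_star_mul_self S).1 hc
  have hS : hs (star S) ≠ ⊤ := by rwa [hs_star]
  have hm : ∀ A : H →L[ℂ] H, hs (A * star S) ≠ ⊤ := fun A =>
    ne_top_of_le_ne_top (ENNReal.mul_ne_top (by simp) hS) (hs_mul_le A (star S))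
  rw [trace_conj_eq, trace_conj_eq, trace_star_mul_self, ← Complex.ofReal_add,
    ← ENNReal.toReal_add (hm _) (hm _), hs_add_eq, hs_star]

theorem norm_trace_conj_le_of_sum {T : H →L[ℂ] H} (hT : 0 ≤ T) (hc : IsTraceClass T) :
    ‖trace (W.B * T * star W.B)‖ ≤ ‖trace T‖ := by
  have h := W.trace_split hT hc
  obtain ⟨S, rfl⟩ := exists_sqrt hT
  rw [trace_conj_eq, trace_conj_eq, trace_star_mul_self] at h
  rw [trace_conj_eq, trace_star_mul_self]
  have h' : (hs (W.B * star S)).toReal + (hs (W.C * star S)).toReal = (hs S).toReal := by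
    exact_mod_cast h
  rw [Complex.norm_real, Complex.norm_real, Real.norm_of_nonneg ENNReal.toReal_nonneg,
    Real.norm_of_nonneg ENNReal.toReal_nonneg]
  linarith [ENNReal.toReal_nonneg (a := hs (W.C * star S))]

/-- One step `ρ ↦ M(ρ)` of the walk. -/
def M (ρ : State H) : State H where
  block := W.stepBlock ρ.block
  nonneg j := add_nonneg (conj_nonneg' (ρ.nonneg _) _) (conj_nonneg' (ρ.nonneg _) _)
  traceClass j := isTraceClass_add (conj_nonneg' (ρ.nonneg _) _) (conj_nonneg' (ρ.nonneg _) _)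
    (isTraceClass_conj (ρ.nonneg _) (ρ.traceClass _) _)
    (isTraceClass_conj (ρ.nonneg _) (ρ.traceClass _) _)
  hasSum_trace := by
    have hB : Summable fun i => trace (W.B * ρ.block i * star W.B) :=
      Summable.of_norm_bounded ρ.hasSum_trace.summable.norm
        fun i => W.norm_trace_conj_le_of_sum (ρ.nonneg i) (ρ.traceClass i)
    have hs : ∀ i, trace (W.B * ρ.block i * star W.B) + trace (W.C * ρ.block i * star W.C)
        = trace (ρ.block i) := fun i => W.trace_split (ρ.nonneg i) (ρ.traceClass i)
    have hC : Summable fun i => trace (W.C * ρ.block i * star W.C) := by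
      refine (ρ.hasSum_trace.summable.sub hB).congr fun i => ?_
      rw [← hs i]; ring
    have h := hB.hasSum.add hC.hasSum
    have h1 : (∑' i, trace (W.B * ρ.block i * star W.B)) +
        (∑' i, trace (W.C * ρ.block i * star W.C)) = 1 := by
      refine h.unique ?_
      simpa only [hs] using ρ.hasSum_trace
    have hB' := (Equiv.hasSum_iff (Equiv.addRight (1 : ℤ))).2 hB.hasSum
    have hC' := (Equiv.hasSum_iff (Equiv.subRight (1 : ℤ))).2 hC.hasSum
    have h2 := hB'.add hC'
    rw [h1] at h2
    convert h2 using 1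
    funext j
    exact trace_add (conj_nonneg' (ρ.nonneg _) _) (conj_nonneg' (ρ.nonneg _) _)
      (isTraceClass_conj (ρ.nonneg _) (ρ.traceClass _) _)
      (isTraceClass_conj (ρ.nonneg _) (ρ.traceClass _) _)

/-- The state `ρ⁽ⁿ⁾ = Mⁿ(ρ⁽⁰⁾)` at time `n`. -/
def stateAt (ρ₀ : State H) (n : ℕ) : State H := W.M^[n] ρ₀

theorem norm_transition_le (ρ : State H) (x y : Obs H) (j : ℤ) :
    ‖(trace (ρ.block j * x j) / trace (ρ.block j)) •
      (star W.B * y (j - 1) * W.B + star W.C * y (j + 1) * W.C)‖ ≤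
    (1 + ‖x‖ ^ 2) / 2 * (‖star W.B‖ * ‖y‖ * ‖W.B‖ + ‖star W.C‖ * ‖y‖ * ‖W.C‖) := by
  have key : ∀ (A Y : H →L[ℂ] H), ‖Y‖ ≤ ‖y‖ → ‖star A * Y * A‖ ≤ ‖star A‖ * ‖y‖ * ‖A‖ :=
    fun A Y hY => (norm_mul_le _ _).trans
      (mul_le_mul_of_nonneg_right ((norm_mul_le _ _).trans
        (mul_le_mul_of_nonneg_left hY (norm_nonneg _))) (norm_nonneg _))
  rw [norm_smul, norm_div]
  refine mul_le_mul ?_ ((norm_add_le _ _).trans (add_le_add (key _ _ (y.norm_coe_le_norm _))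
    (key _ _ (y.norm_coe_le_norm _)))) (norm_nonneg _) (by positivity)
  refine div_le_of_le_mul₀ (norm_nonneg _) (by positivity) ?_
  refine (norm_trace_mul_le (ρ.nonneg j) (ρ.traceClass j) (x j)).trans ?_
  have := x.norm_coe_le_norm j
  gcongr

/-- The transition expectation attached to the state `ρ`:
`E(x ⊗ y) = ∑_{j : ρⱼ ≠ 0} ∑ᵢ (Tr (ρⱼ x(j)) / Tr ρⱼ) (Bⱼⁱ)* y(i) Bⱼⁱ ⊗ |j⟩⟨j|`
with `Bⱼʲ⁻¹ = B`, `Bⱼʲ⁺¹ = C` and `Bⱼⁱ = 0` otherwise (the quotient is `0` if `ρⱼ = 0`). -/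
def transition (ρ : State H) : Obs H →ₗ[ℂ] Obs H →ₗ[ℂ] Obs H :=
  LinearMap.mk₂ ℂ
    (fun x y => BoundedContinuousFunction.ofNormedAddCommGroupDiscrete
      (fun j => (trace (ρ.block j * x j) / trace (ρ.block j)) •
        (star W.B * y (j - 1) * W.B + star W.C * y (j + 1) * W.C)) _
      (W.norm_transition_le ρ x y))
    (fun x x' y => by
      ext1 j
      simp only [BoundedContinuousFunction.coe_ofNormedAddCommGroupDiscrete,
        BoundedContinuousFunction.coe_add, Pi.add_apply,
        trace_mul_add (ρ.nonneg j) (ρ.traceClass j), add_div, add_smul])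
    (fun c x y => by
      ext1 j
      simp only [BoundedContinuousFunction.coe_ofNormedAddCommGroupDiscrete,
        BoundedContinuousFunction.coe_smul, trace_mul_smul, mul_div_assoc]
      rw [mul_smul])
    (fun x y y' => by
      ext1 j
      simp only [BoundedContinuousFunction.coe_ofNormedAddCommGroupDiscrete,
        BoundedContinuousFunction.coe_add, Pi.add_apply, ← smul_add]
      congr 1
      noncomm_ring)
    (fun c x y => by
      ext1 j
      simp only [BoundedContinuousFunction.coe_ofNormedAddCommGroupDiscrete,
        BoundedContinuousFunction.coe_smul, mul_smul_comm, smul_mul_assoc, ← smul_add]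
      rw [smul_comm])

/-- The quantum Markov chain `(ρ⁽⁰⁾, (E⁽ⁿ⁾))` associated with the walk and the initial state `ρ⁽⁰⁾`
(`E⁽ⁿ⁾` being the transition expectation attached to `ρ⁽ⁿ⁾`) is irreducible. -/
def IsIrreducible (ρ₀ : State H) : Prop :=
  ¬ IsReducible fun n => W.transition (W.stateAt ρ₀ n)

end NNWalk

end OQRW

end

open scoped ComplexOrder

namespace OQRW

variable {H : Type*} [NormedAddCommGroup H] [InnerProductSpace ℂ H] [CompleteSpace H]

/-! ### The trace pairing on positive operators -/

/-! Faithfulness rests on the duality `Tr (M(ρ)ⱼ a) = Tr (ρⱼ₊₁ B* a B) + Tr (ρⱼ₋₁ C* a C)`. For `a ≥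
0` both terms are nonnegative, so if the left side vanishes then so do they; faithfulness of `ρ`
gives `B* a B = C* a C = 0`, and the hypothesis gives `a = 0`. By induction every `ρ⁽ⁿ⁾` is
faithful.

Consequently `E⁽ⁿ⁾(I ⊗ y)` is the unital Heisenberg map `dual y`, and every `b̄(n)` equals `I`. If
`p` is reducing from time `n₀` on, testing with `a = I` shows that the expectations of the truncated
projections converge strongly to `I`. The first factor `p` caps each of them by `dual^n₀(w)`, where
`w(j) = Tr (ρⱼ p(j)) / Tr ρⱼ` at time `n₀`; the later factors only lower the value
(`nested_le_iterate_dual`). Hence `I ≤ dual^n₀(w)` with `w ≤ I`. The hypothesis makes `dual`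
injective on positive families, so `w = I` (`eq_one_of_one_le_iterate_dual`). Then `Tr (ρⱼ (I -
p(j))) = 0` for every `j`, and faithfulness forces `p = I`. -/

theorem summable_sq_matrix_entries {S : H →L[ℂ] H} (hS : hs S ≠ ⊤) :
    Summable fun q : basisSet H × basisSet H =>
      ‖⟪basis H q.2, S (basis H q.1)⟫_ℂ‖ ^ 2 := by
  have h : ∑' q : basisSet H × basisSet H, ‖⟪basis H q.2, S (basis H q.1)⟫_ℂ‖ₑ ^ 2 ≠ ⊤ := by
    rw [ENNReal.tsum_prod']
    simp_rw [tsum_enorm_inner_sq]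
    exact hS
  simpa using ENNReal.summable_toReal h

/-- The Hilbert-Schmidt inner product is conjugated by taking adjoints. -/
theorem tsum_inner_eq_tsum_inner_star {S Y : H →L[ℂ] H} (hS : hs S ≠ ⊤) (hY : hs Y ≠ ⊤) :
    ∑' k, ⟪S (basis H k), Y (basis H k)⟫_ℂ =
      ∑' k, ⟪star Y (basis H k), star S (basis H k)⟫_ℂ := by
  -- By AM-GM on matrix entries the double series converges absolutely, which justifies exchanging
  -- the two sums.
  have key : Summable (Function.uncurry fun k l : basisSet H =>
      ⟪S (basis H k), basis H l⟫_ℂ * ⟪basis H l, Y (basis H k)⟫_ℂ) := by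
    refine Summable.of_norm_bounded
      (((summable_sq_matrix_entries hS).add (summable_sq_matrix_entries hY)).div_const 2) ?_
    rintro ⟨k, l⟩
    simp only [Function.uncurry_apply_pair, norm_mul]
    rw [norm_inner_symm (S (basis H k))]
    nlinarith [sq_nonneg (‖⟪basis H l, S (basis H k)⟫_ℂ‖ - ‖⟪basis H l, Y (basis H k)⟫_ℂ‖)]
  have h1 : ∀ k, ⟪S (basis H k), Y (basis H k)⟫_ℂ =
      ∑' l, ⟪S (basis H k), basis H l⟫_ℂ * ⟪basis H l, Y (basis H k)⟫_ℂ := fun k =>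
    ((basis H).tsum_inner_mul_inner _ _).symm
  rw [tsum_congr h1, ← key.tsum_comm]
  refine tsum_congr fun l => Eq.trans ?_ ((basis H).tsum_inner_mul_inner _ _)
  refine tsum_congr fun k => ?_
  rw [ContinuousLinearMap.star_eq_adjoint, ContinuousLinearMap.star_eq_adjoint,
    ContinuousLinearMap.adjoint_inner_left, ContinuousLinearMap.adjoint_inner_right, mul_comm]

/-- This takes the place of cyclicity of the trace: once both positive factors are squares, the
pairing is a squared Hilbert-Schmidt norm, hence visibly nonnegative. -/
theorem trace_star_mul_self_mul_star_mul_self {S : H →L[ℂ] H} (hS : hs S ≠ ⊤) (A : H →L[ℂ] H) :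
    trace (star S * S * (star A * A)) = ((hs (S * star A)).toReal : ℂ) := by
  have h1 : hs (S * (star A * A)) ≠ ⊤ := hs_ne_top_mul hS _
  rw [← hs_star (S * star A), toReal_hs, Complex.ofReal_tsum]
  unfold trace
  simp_rw [mul_assoc (star S), inner_star_mul]
  rw [tsum_inner_eq_tsum_inner_star hS h1]
  refine tsum_congr fun k => ?_
  have h2 : star (S * (star A * A)) = star A * star (S * star A) := by simp [mul_assoc]
  have h3 : A (star S (basis H k)) = star (S * star A) (basis H k) := by
    rw [← mul_apply_eq_comp]; simp
  have h4 : ∀ x y : H, ⟪star A x, y⟫_ℂ = ⟪x, A y⟫_ℂ := fun x y =>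
    ContinuousLinearMap.adjoint_inner_left A y x
  rw [h2, mul_apply_eq_comp, h4, h3, inner_self_eq_norm_sq_to_K]
  norm_cast

theorem trace_mul_nonneg {T x : H →L[ℂ] H} (hT : 0 ≤ T) (hc : IsTraceClass T) (hx : 0 ≤ x) :
    0 ≤ trace (T * x) := by
  obtain ⟨S, rfl⟩ := exists_sqrt hT
  obtain ⟨A, rfl⟩ := exists_sqrt hx
  rw [trace_star_mul_self_mul_star_mul_self ((isTraceClass_star_mul_self S).1 hc)]
  exact Complex.zero_le_real.2 ENNReal.toReal_nonneg

/-- Passage from the Schrödinger to the Heisenberg picture: with `T = S* S` and `x = R* R`, both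
sides are the squared Hilbert-Schmidt norm of `S A* R*`. -/
theorem trace_conj_mul {T x : H →L[ℂ] H} (hT : 0 ≤ T) (hc : IsTraceClass T) (hx : 0 ≤ x)
    (A : H →L[ℂ] H) : trace (A * T * star A * x) = trace (T * (star A * x * A)) := by
  obtain ⟨S, rfl⟩ := exists_sqrt hT
  obtain ⟨R, rfl⟩ := exists_sqrt hx
  have hS := (isTraceClass_star_mul_self S).1 hc
  have h : star A * (star R * R) * A = star (R * A) * (R * A) := by simp [mul_assoc]
  rw [NNWalk.star_conj_eq, trace_star_mul_self_mul_star_mul_self (hs_ne_top_mul hS _), h,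
    trace_star_mul_self_mul_star_mul_self hS]
  simp [mul_assoc]

theorem trace_add_mul {T U : H →L[ℂ] H} (hT : 0 ≤ T) (hU : 0 ≤ U) (hc : IsTraceClass T)
    (hd : IsTraceClass U) (x : H →L[ℂ] H) :
    trace ((T + U) * x) = trace (T * x) + trace (U * x) := by
  unfold trace
  rw [← (summable_trace_mul hT hc x).tsum_add (summable_trace_mul hU hd x)]
  refine tsum_congr fun k => ?_
  rw [add_mul, add_apply, inner_add_right]

theorem trace_mul_le_trace {T x : H →L[ℂ] H} (hT : 0 ≤ T) (hc : IsTraceClass T) (hx : x ≤ 1) :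
    trace (T * x) ≤ trace T := by
  have h := trace_mul_nonneg hT hc (sub_nonneg.2 hx)
  have h2 := trace_mul_add hT hc x (1 - x)
  rw [add_sub_cancel, mul_one] at h2
  rw [h2]
  exact le_add_of_nonneg_right h

/-! ### Faithful states -/

theorem State.trace_mul_eq_zero_of_expect_eq_zero (ρ : State H) {a : Obs H} (ha : ∀ i, 0 ≤ a i)
    (h : ρ.expect a = 0) (i : ℤ) : trace (ρ.block i * a i) = 0 := by
  -- Without summability, the vanishing of `expect` could be just the default value of a divergent
  -- `tsum`.
  have hsum : Summable fun i => trace (ρ.block i * a i) :=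
    Summable.of_norm_bounded (ρ.hasSum_trace.summable.norm.mul_left ((1 + ‖a‖ ^ 2) / 2))
      fun i => (norm_trace_mul_le (ρ.nonneg i) (ρ.traceClass i) (a i)).trans (by
        have := a.norm_coe_le_norm i
        gcongr)
  have hnn : ∀ i, 0 ≤ trace (ρ.block i * a i) := fun i =>
    trace_mul_nonneg (ρ.nonneg i) (ρ.traceClass i) (ha i)
  have hz : HasSum (fun i => trace (ρ.block i * a i)) 0 := h ▸ hsum.hasSum
  exact congrFun ((hasSum_zero_iff_of_nonneg hnn).1 hz) i

/-- Faithfulness localizes to each block: test it on the observable carrying `x` at site `j` and `0`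
elsewhere. -/
theorem State.Faithful.eq_zero_of_trace_mul_eq_zero {ρ : State H} (hρ : ρ.Faithful) (j : ℤ)
    {x : H →L[ℂ] H} (hx : 0 ≤ x) (h : trace (ρ.block j * x) = 0) : x = 0 := by
  classical
  let a : Obs H := BoundedContinuousFunction.ofNormedAddCommGroupDiscrete (Pi.single j x) ‖x‖
    fun i => by
      by_cases hi : i = j
      · subst hi; simp
      · simp [Pi.single_eq_of_ne hi]
  have ha : ∀ i, a i = (Pi.single j x : ℤ → (H →L[ℂ] H)) i := fun i => rfl
  have h0 : a = 0 := by
    refine hρ a (fun i => ?_) ?_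
    · rw [ha]
      by_cases hi : i = j
      · subst hi; simpa using hx
      · simp [Pi.single_eq_of_ne hi]
    · unfold State.expect
      rw [tsum_eq_single j fun i hi => by simp [ha, Pi.single_eq_of_ne hi, trace]]
      simpa [ha] using h
  have := DFunLike.congr_fun h0 j
  simpa [ha] using this

namespace NNWalk

variable (W : NNWalk H)

theorem faithful_M (hW : ∀ x : H →L[ℂ] H, 0 ≤ x → star W.B * x * W.B = 0 →
    star W.C * x * W.C = 0 → x = 0) {ρ : State H} (hρ : ρ.Faithful) : (W.M ρ).Faithful := by
  intro a ha h
  ext1 j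
  have hj : trace (W.stepBlock ρ.block j * a j) = 0 :=
    (W.M ρ).trace_mul_eq_zero_of_expect_eq_zero ha h j
  unfold stepBlock at hj
  have hB := conj_nonneg' (ρ.nonneg (j + 1)) W.B
  have hC := conj_nonneg' (ρ.nonneg (j - 1)) W.C
  have hB' := isTraceClass_conj (ρ.nonneg (j + 1)) (ρ.traceClass (j + 1)) W.B
  have hC' := isTraceClass_conj (ρ.nonneg (j - 1)) (ρ.traceClass (j - 1)) W.C
  rw [trace_add_mul hB hC hB' hC', add_eq_zero_iff_of_nonneg (trace_mul_nonneg hB hB' (ha j))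
    (trace_mul_nonneg hC hC' (ha j)), trace_conj_mul (ρ.nonneg _) (ρ.traceClass _) (ha j),
    trace_conj_mul (ρ.nonneg _) (ρ.traceClass _) (ha j)] at hj
  exact hW _ (ha j)
    (hρ.eq_zero_of_trace_mul_eq_zero _ (star_left_conjugate_nonneg (ha j) _) hj.1)
    (hρ.eq_zero_of_trace_mul_eq_zero _ (star_left_conjugate_nonneg (ha j) _) hj.2)

theorem faithful_stateAt (hW : ∀ x : H →L[ℂ] H, 0 ≤ x → star W.B * x * W.B = 0 →
    star W.C * x * W.C = 0 → x = 0) {ρ₀ : State H} (hρ : ρ₀.Faithful) (n : ℕ) :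
    (W.stateAt ρ₀ n).Faithful := by
  induction n with
  | zero => exact hρ
  | succ n ih =>
    unfold stateAt at ih ⊢
    rw [Function.iterate_succ_apply']
    exact W.faithful_M hW ih

end NNWalk

/-! ### Order facts for operators and observables -/

/-- Quadratic forms pass to strong limits, so the bound by `F` survives; `hF` serves to make `F - 1`
self-adjoint. -/
theorem one_le_of_tendsto_of_le {u : ℕ → (H →L[ℂ] H)} {F : H →L[ℂ] H} (hF : 0 ≤ F)
    (hu : ∀ ψ, Filter.Tendsto (fun n => u n ψ) Filter.atTop (nhds ψ))
    (hle : ∀ᶠ n in Filter.atTop, u n ≤ F) : 1 ≤ F := by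
  rw [ContinuousLinearMap.le_def, ContinuousLinearMap.isPositive_def']
  refine ⟨(IsSelfAdjoint.of_nonneg hF).sub (.one _), fun ψ => ?_⟩
  have hlim : Filter.Tendsto (fun n => (F - u n).reApplyInnerSelf ψ) Filter.atTop
      (nhds ((F - 1).reApplyInnerSelf ψ)) := by
    simp only [ContinuousLinearMap.reApplyInnerSelf_apply, sub_apply, one_apply_eq_self]
    exact (RCLike.continuous_re.tendsto _).comp
      ((tendsto_const_nhds.sub (hu ψ)).inner tendsto_const_nhds)
  refine ge_of_tendsto hlim (hle.mono fun n hn => ?_)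
  exact ((ContinuousLinearMap.isPositive_def').1 ((ContinuousLinearMap.le_def _ _).1 hn)).2 ψ

theorem complex_smul_nonneg {r : ℂ} (hr : 0 ≤ r) {A : H →L[ℂ] H} (hA : 0 ≤ A) : 0 ≤ r • A :=
  smul_nonneg hr hA

theorem complex_smul_le_smul {r : ℂ} (hr : 0 ≤ r) {A A' : H →L[ℂ] H} (h : A ≤ A') :
    r • A ≤ r • A' := by
  rw [← sub_nonneg, ← smul_sub]
  exact complex_smul_nonneg hr (sub_nonneg.2 h)

theorem obs_le_one {p : Obs H} (hp : IsStarProjection p) (j : ℤ) : 0 ≤ p j ∧ p j ≤ 1 := by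
  have h : IsStarProjection (p j) :=
    ⟨DFunLike.congr_fun hp.isIdempotentElem j, DFunLike.congr_fun hp.isSelfAdjoint j⟩
  exact ⟨h.nonneg, h.le_one⟩

/-! ### Expectations of product observables -/

section Nested

variable (E : ℕ → (Obs H →ₗ[ℂ] Obs H →ₗ[ℂ] Obs H))

theorem nested_succ (l m : ℕ) (v : Fin (l + 1) → Obs H) :
    nested E (l + 1) m v = E m (v 0) (nested E l (m + 1) (Fin.tail v)) := rfl

theorem bBar_eq_one (h : ∀ n, E n 1 1 = 1) (n : ℕ) : bBar E n = 1 := by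
  have h1 : ∀ k n, unitIter E n k = 1 := by
    intro k
    induction k with
    | zero => exact h
    | succ k ih => intro n; rw [unitIter, ih, h]
  have h2 : StrongTendsto (unitIter E n) 1 := by
    intro i ψ
    simp only [h1]
    exact tendsto_const_nhds
  -- Strong limits are unique, so the limit selected by `Classical.epsilon` has to be `1`.
  have h3 : StrongTendsto (unitIter E n) (bBar E n) := Classical.epsilon_spec ⟨1, h2⟩
  ext i ψ
  exact tendsto_nhds_unique (h3 i ψ) (h2 i ψ)

end Nested

theorem truncProj_mul_extend_one_mul_truncProj {p : Obs H} (hp : IsStarProjection p)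
    (n₀ m k : ℕ) :
    truncProj p n₀ (m + k) * (1 : Local H m).extend k * truncProj p n₀ (m + k) =
      truncProj p n₀ (m + k) := by
  have h : (1 : Local H m).extend k = PiTensorProduct.tprod ℂ fun _ => 1 := by
    rw [PiTensorProduct.one_def, Local.extend_tprod]
    congr 1
    funext i
    refine Fin.addCases (fun j => ?_) (fun j => ?_) i <;> simp
  rw [h]
  unfold truncProj
  rw [PiTensorProduct.tprod_mul_tprod, PiTensorProduct.tprod_mul_tprod]
  congr 1
  funext i
  simp only [Pi.mul_apply, mul_one]
  split_ifs
  · rfl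
  · exact hp.isIdempotentElem

/-! ### The Heisenberg map and bounds on transition expectations -/

namespace NNWalk

variable (W : NNWalk H)

/-- The Heisenberg evolution `y ↦ ∑ⱼ (B* y(j-1) B + C* y(j+1) C) ⊗ |j⟩⟨j|`. -/
noncomputable def dual (y : ℤ → (H →L[ℂ] H)) (j : ℤ) : H →L[ℂ] H :=
  star W.B * y (j - 1) * W.B + star W.C * y (j + 1) * W.C

theorem transition_apply (ρ : State H) (x y : Obs H) (j : ℤ) :
    W.transition ρ x y j =
      (trace (ρ.block j * x j) / trace (ρ.block j)) • W.dual y j := rfl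

theorem dual_one : W.dual 1 = 1 := by
  funext j
  simp [dual, W.isometry]

theorem dual_nonneg {y : ℤ → (H →L[ℂ] H)} (hy : 0 ≤ y) : 0 ≤ W.dual y := fun _ =>
  add_nonneg (star_left_conjugate_nonneg (hy _) _) (star_left_conjugate_nonneg (hy _) _)

theorem dual_sub (y z : ℤ → (H →L[ℂ] H)) : W.dual (y - z) = W.dual y - W.dual z := by
  funext j
  simp only [dual, Pi.sub_apply]
  noncomm_ring

theorem dual_mono {y z : ℤ → (H →L[ℂ] H)} (h : y ≤ z) : W.dual y ≤ W.dual z := by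
  rw [← sub_nonneg, ← dual_sub]
  exact W.dual_nonneg (sub_nonneg.2 h)

theorem iterate_dual_nonneg {y : ℤ → (H →L[ℂ] H)} (hy : 0 ≤ y) (d : ℕ) : 0 ≤ W.dual^[d] y := by
  induction d generalizing y with
  | zero => exact hy
  | succ d ih => exact ih (W.dual_nonneg hy)

variable {W} in
-- As `dual` is monotone and unital, induction yields `dual y = 1`, that is, `dual (1 - y) = 0`.
-- Each block of this is a sum of two positive operators, so both vanish and the hypothesis on `B`
-- and `C` applies.
theorem eq_one_of_one_le_iterate_dual (hW : ∀ x : H →L[ℂ] H, 0 ≤ x → star W.B * x * W.B = 0 →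
    star W.C * x * W.C = 0 → x = 0) {y : ℤ → (H →L[ℂ] H)} (hy : y ≤ 1) (d : ℕ)
    (h : 1 ≤ W.dual^[d] y) : y = 1 := by
  induction d generalizing y with
  | zero => exact le_antisymm hy h
  | succ d ih =>
    have h1 : W.dual y = 1 := ih ((W.dual_mono hy).trans_eq W.dual_one) h
    have h2 : W.dual (1 - y) = 0 := by rw [dual_sub, h1, dual_one, sub_self]
    have hn : ∀ j, 0 ≤ (1 - y) j := sub_nonneg.2 hy
    have h3 : ∀ j, star W.B * (1 - y) (j - 1) * W.B = 0 ∧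
        star W.C * (1 - y) (j + 1) * W.C = 0 := fun j =>
      (add_eq_zero_iff_of_nonneg (star_left_conjugate_nonneg (hn _) _)
        (star_left_conjugate_nonneg (hn _) _)).1 (congrFun h2 j)
    funext j
    refine (sub_eq_zero.1 (hW _ (hn j) ?_ ?_)).symm
    -- The block at `j` is seen through `B` from site `j + 1` and through `C` from site `j - 1`.
    · simpa using (h3 (j + 1)).1
    · simpa using (h3 (j - 1)).2

theorem weight_nonneg (ρ : State H) {x : Obs H} (j : ℤ) (hx : 0 ≤ x j) :
    0 ≤ trace (ρ.block j * x j) / trace (ρ.block j) := by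
  have h := trace_mul_nonneg (ρ.nonneg j) (ρ.traceClass j) zero_le_one
  rw [mul_one] at h
  exact div_nonneg (trace_mul_nonneg (ρ.nonneg j) (ρ.traceClass j) hx) h

theorem weight_le_one (ρ : State H) {x : Obs H} (j : ℤ) (hx : x j ≤ 1) :
    trace (ρ.block j * x j) / trace (ρ.block j) ≤ 1 := by
  have h := trace_mul_nonneg (ρ.nonneg j) (ρ.traceClass j) zero_le_one
  rw [mul_one] at h
  rcases h.eq_or_lt with h0 | h0
  -- A block of trace zero has weight `0`, by the convention for division by zero.
  · rw [← h0, div_zero]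
    exact zero_le_one
  · have h1 := mul_le_mul_of_nonneg_right
      (trace_mul_le_trace (ρ.nonneg j) (ρ.traceClass j) hx) (inv_nonneg.2 h)
    rwa [mul_inv_cancel₀ h0.ne', ← div_eq_mul_inv] at h1

/-- The multiple `Tr (ρⱼ x(j)) / Tr ρⱼ` of the identity at each site `j`. -/
noncomputable def weight (ρ : State H) (x : Obs H) (j : ℤ) : H →L[ℂ] H :=
  (trace (ρ.block j * x j) / trace (ρ.block j)) • 1

theorem weight_operator_nonneg (ρ : State H) {x : Obs H} (hx : ∀ j, 0 ≤ x j) :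
    0 ≤ weight ρ x := fun j =>
  complex_smul_nonneg (weight_nonneg ρ j (hx j)) zero_le_one

theorem weight_operator_le_one (ρ : State H) {x : Obs H} (hx : ∀ j, x j ≤ 1) :
    weight ρ x ≤ 1 := fun j => by
  have := complex_smul_nonneg (sub_nonneg.2 (weight_le_one ρ j (hx j)))
    (zero_le_one (α := H →L[ℂ] H))
  rw [sub_smul, one_smul] at this
  exact sub_nonneg.1 this

theorem transition_nonneg (ρ : State H) {x y : Obs H} (hx : ∀ j, 0 ≤ x j) (hy : ∀ j, 0 ≤ y j)
    (j : ℤ) : 0 ≤ W.transition ρ x y j :=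
  complex_smul_nonneg (weight_nonneg ρ j (hx j)) (W.dual_nonneg hy j)

/-- The second argument enters only through `y ≤ 1`, so the bound does not depend on how many
factors follow. -/
theorem transition_le_weight (ρ : State H) {x y : Obs H} (hx : ∀ j, 0 ≤ x j)
    (hy : ∀ j, y j ≤ 1) (j : ℤ) : W.transition ρ x y j ≤ weight ρ x j :=
  complex_smul_le_smul (weight_nonneg ρ j (hx j))
    (((W.dual_mono (z := 1) hy) j).trans_eq (congrFun W.dual_one j))

theorem transition_one {ρ : State H} (hρ : ρ.Faithful) (y : Obs H) (j : ℤ) :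
    W.transition ρ 1 y j = W.dual y j := by
  -- A faithful state has a block of trace zero only when `H` is trivial, and then all operators
  -- coincide.
  by_cases h : trace (ρ.block j) = 0
  · have h1 : (1 : H →L[ℂ] H) = 0 :=
      hρ.eq_zero_of_trace_mul_eq_zero j zero_le_one (by rwa [mul_one])
    exact eq_of_zero_eq_one h1.symm _ _
  · rw [transition_apply, BoundedContinuousFunction.coe_one, Pi.one_apply, mul_one, div_self h,
      one_smul]

/-! ### Expectations of products along the chain -/

section Chain

variable {W} {ρ : ℕ → State H}

theorem bBar_transition (hρ : ∀ n, (ρ n).Faithful) (n : ℕ) :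
    bBar (fun n => W.transition (ρ n)) n = 1 := by
  refine bBar_eq_one _ (fun n => ?_) n
  ext1 j
  rw [W.transition_one (hρ n), BoundedContinuousFunction.coe_one, W.dual_one]

theorem nested_mem_Icc (hρ : ∀ n, (ρ n).Faithful) (l m : ℕ) {v : Fin l → Obs H}
    (hv : ∀ k j, 0 ≤ v k j ∧ v k j ≤ 1) (j : ℤ) :
    0 ≤ nested (fun n => W.transition (ρ n)) l m v j ∧
      nested (fun n => W.transition (ρ n)) l m v j ≤ 1 := by
  induction l generalizing m j with
  | zero =>
    have h : nested (fun n => W.transition (ρ n)) 0 m v = 1 := bBar_transition hρ m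
    rw [h]
    exact ⟨zero_le_one, le_rfl⟩
  | succ l ih =>
    rw [nested_succ]
    have h := ih (m + 1) (v := Fin.tail v) fun k => hv k.succ
    exact ⟨W.transition_nonneg _ (fun j => (hv 0 j).1) (fun j => (h j).1) j,
      (W.transition_le_weight _ (fun j => (hv 0 j).1) (fun j => (h j).2) j).trans
        (weight_operator_le_one _ (fun j => (hv 0 j).2) j)⟩

/-- Each of the `d` leading identities applies `dual`, and the first `p`, at time `m + d`,
contributes at most its weight. The condition `d < l` ensures that this `p` is present. -/
theorem nested_le_iterate_dual (hρ : ∀ n, (ρ n).Faithful) {p : Obs H}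
    (hp : ∀ j, 0 ≤ p j ∧ p j ≤ 1) (d l m : ℕ) (hl : d < l) (j : ℤ) :
    nested (fun n => W.transition (ρ n)) l m (fun k => if (k : ℕ) < d then 1 else p) j ≤
      W.dual^[d] (weight (ρ (m + d)) p) j := by
  induction d generalizing l m j with
  | zero =>
    obtain ⟨l, rfl⟩ := Nat.exists_eq_succ_of_ne_zero hl.ne'
    rw [nested_succ]
    exact W.transition_le_weight _ (fun j => (hp j).1)
      (fun j => (nested_mem_Icc hρ l (m + 1) (fun _ => hp) j).2) j
  | succ d ih =>
    obtain ⟨l, rfl⟩ := Nat.exists_eq_succ_of_ne_zero (Nat.ne_zero_of_lt hl)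
    have ht : Fin.tail (fun k : Fin (l + 1) => if (k : ℕ) < d + 1 then (1 : Obs H) else p) =
        fun k : Fin l => if (k : ℕ) < d then 1 else p := by
      funext k
      simp [Fin.tail]
    rw [nested_succ, ht, Function.iterate_succ_apply']
    simp only [Fin.val_zero, Nat.succ_pos, if_true]
    rw [W.transition_one (hρ m)]
    have h := ih l (m + 1) (Nat.lt_of_succ_lt_succ hl)
    rw [Nat.succ_add_eq_add_succ] at h
    exact W.dual_mono h j

end Chain

/-! ### Irreducibility -/

variable {W} in
theorem isIrreducible_of_faithful (hW : ∀ x : H →L[ℂ] H, 0 ≤ x → star W.B * x * W.B = 0 →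
    star W.C * x * W.C = 0 → x = 0) {ρ₀ : State H} (hρ₀ : ρ₀.Faithful) :
    W.IsIrreducible ρ₀ := by
  rintro ⟨p, n₀, hp, -, hp1, hred⟩
  have hρ := W.faithful_stateAt hW hρ₀
  have hpI := obs_le_one hp
  -- The unit localized in zero sites is the only observable that needs testing.
  have hlim := hred 0 1
  simp only [truncProj_mul_extend_one_mul_truncProj hp] at hlim
  have h1 : expectZero (fun n => W.transition (W.stateAt ρ₀ n)) 0 1 = 1 := by
    unfold expectZero
    rw [PiTensorProduct.one_def, PiTensorProduct.lift.tprod]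
    exact bBar_transition hρ 0
  rw [h1] at hlim
  have hle : ∀ j, 1 ≤ W.dual^[n₀] (weight (W.stateAt ρ₀ n₀) p) j := fun j => by
    refine one_le_of_tendsto_of_le
      (W.iterate_dual_nonneg (weight_operator_nonneg _ fun j => (hpI j).1) n₀ j) (hlim j) ?_
    -- Only truncations longer than `n₀` contain a factor `p`.
    filter_upwards [Filter.eventually_gt_atTop n₀] with k hk
    unfold expectZero truncProj
    rw [PiTensorProduct.lift.tprod]
    have := nested_le_iterate_dual (W := W) hρ hpI n₀ (0 + k) 0 (by omega) j
    rwa [zero_add n₀] at this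
  have hw := eq_one_of_one_le_iterate_dual hW
    (weight_operator_le_one _ fun j => (hpI j).2) n₀ hle
  apply hp1
  ext1 j
  -- For trivial `H` the scalar weight cannot be recovered from its multiple of the identity.
  by_cases hne : (1 : H →L[ℂ] H) = 0
  · exact eq_of_zero_eq_one hne.symm _ _
  have hq : trace ((W.stateAt ρ₀ n₀).block j * p j) / trace ((W.stateAt ρ₀ n₀).block j) = 1 := by
    have := congrFun hw j
    refine smul_left_injective ℂ hne ?_
    simpa [weight] using this
  have ht := eq_of_div_eq_one hq
  have hadd := trace_mul_add ((W.stateAt ρ₀ n₀).nonneg j) ((W.stateAt ρ₀ n₀).traceClass j)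
    (p j) (1 - p j)
  rw [add_sub_cancel, mul_one, ht, left_eq_add] at hadd
  exact (sub_eq_zero.1 ((hρ n₀).eq_zero_of_trace_mul_eq_zero j
    (sub_nonneg.2 (hpI j).2) hadd)).symm

end NNWalk

end OQRW

theorem mainTheorem10 {H : Type*} [NormedAddCommGroup H] [InnerProductSpace ℂ H] [CompleteSpace H]
    [TopologicalSpace.SeparableSpace H] (W : OQRW.NNWalk H)
    (hW : ∀ x : H →L[ℂ] H, 0 ≤ x → star W.B * x * W.B = 0 → star W.C * x * W.C = 0 → x = 0) :
    (∀ ρ : OQRW.State H, ρ.Faithful → (W.M ρ).Faithful) ∧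
      ∀ ρ₀ : OQRW.State H, ρ₀.Faithful → W.IsIrreducible ρ₀ :=
  ⟨fun _ => W.faithful_M hW, fun _ => OQRW.NNWalk.isIrreducible_of_faithful hW⟩
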